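/- Let $M,N,K\ge 1$ be integers and let $\Theta_{mn}$ ($1\le m\le M$, $1\le n\le N$) be i.i.d. random variables, uniform on $[0,2\pi)$. Let $A=[a_1,\dots,a_N]\in\mathbb C^{M\times N}$ be the random phase-rotated matrix with entries $A_{mn}=\frac1{\sqrt M}e^{j\Theta_{mn}}$. Let $x\in\mathbb C^N$ be a fixed vector with exactly $K$ nonzero entries, $S=\operatorname{supp}(x)$, and $y=Ax$. Orthogonal matching pursuit (OMP) starts from $S_0=\emptyset$, $r_0=y$. For $t=1,\dots,K$ it picks $i_t\in\operatorname{argmax}_{n\notin S_{t-1}}|a_n^*r_{t-1}|$, where ties are broken by an arbitrary fixed rule (one that depends only on $S_{t-1}$ and on the set of maximizers), sets $S_t=S_{t-1}\cup\{i_t\}$, lets $\hat x_t$ be a minimizer of $\|y-Az\|_2^2$ over all $z\in\mathbb C^N$ with $\operatorname{supp}(z)\subseteq S_t$, and sets $r_t=y-A\hat x_t$. It returns $\hat S=S_K$. Let $\mathcal V_{\mathrm{SSD}}$ be the event of successful support detection: $\hat S=S$, and in every iteration $t=1,\dots,K$ the greedy selection condition $\|A_{S^c}^*r_{t-1}\|_\infty<\|A_S^*r_{t-1}\|_\infty$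 holds, where $A_S$ and $A_{S^c}$ are the submatrices of the columns of $A$ indexed by $S$ and by its complement. Then, for every $g>2$, $$\Pr(\mathcal V_{\mathrm{SSD}})\ \ge\ 1-\Big(1-\frac2g\Big)^{-1/2}KN\,e^{-\frac{M}{gK^2}}.$$ Moreover, for every $g>2$ and $\epsilon\in(0,1)$, if $$M\ \ge\ gK^2\ln\!\bigg(\frac{KN}{\epsilon\sqrt{1-2/g}}\bigg),$$ then $\Pr(\mathcal V_{\mathrm{SSD}})\ge 1-\epsilon$. In particular, in both cases OMP recovers the support of $x$ with at least the stated probability. -/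

import Mathlib

open MeasureTheory ProbabilityTheory

noncomputable section

namespace RPR

/-- The random phase-rotated matrix with phases `θ`: its entries are `exp (j θ m n) / √M`. -/
def rprMatrix {M N : ℕ} (θ : Fin M → Fin N → ℝ) : Matrix (Fin M) (Fin N) ℂ :=
  Matrix.of fun m n => ((1 / √(M : ℝ) : ℝ) : ℂ) * Complex.exp (Complex.I * (θ m n : ℂ))

/-- The support of a vector. -/
def supp {N : ℕ} (x : Fin N → ℂ) : Finset (Fin N) :=
  Finset.univ.filter fun n => x n ≠ 0

/-- The Euclidean norm on `ℂ^M` (the norm that Mathlib puts on `Fin M → ℂ` is the sup norm). -/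
def l2norm {M : ℕ} (v : Fin M → ℂ) : ℝ := ‖(WithLp.toLp 2 v : EuclideanSpace ℂ (Fin M))‖

/-- The absolute correlation `|aₙ^* r|` of the `n`-th column of `A` with `r`. -/
def corr {M N : ℕ} (A : Matrix (Fin M) (Fin N) ℂ) (r : Fin M → ℂ) (n : Fin N) : ℝ :=
  ‖star (A.col n) ⬝ᵥ r‖

/-- The set of all maximizers of `|aₙ^* r|` over the indices `n` outside `T`. -/
def maximizers {M N : ℕ} (A : Matrix (Fin M) (Fin N) ℂ) (r : Fin M → ℂ) (T : Finset (Fin N)) :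
    Finset (Fin N) :=
  open Classical in Tᶜ.filter fun n => ∀ k ∈ Tᶜ, corr A r k ≤ corr A r n

/-- `z` minimizes `‖y - A z‖₂²` among the vectors supported in `T`. -/
def IsLeastSquares {M N : ℕ} (A : Matrix (Fin M) (Fin N) ℂ) (y : Fin M → ℂ)
    (T : Finset (Fin N)) (z : Fin N → ℂ) : Prop :=
  supp z ⊆ T ∧ ∀ w : Fin N → ℂ, supp w ⊆ T →
    l2norm (y - A.mulVec z) ^ 2 ≤ l2norm (y - A.mulVec w) ^ 2

theorem exists_isLeastSquares {M N : ℕ} (A : Matrix (Fin M) (Fin N) ℂ) (y : Fin M → ℂ)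
    (T : Finset (Fin N)) : ∃ z, IsLeastSquares A y T z := by
  let V : Submodule ℂ (Fin N → ℂ) :=
    { carrier := {z | supp z ⊆ T}
      add_mem' := by
        intro a b ha hb n hn
        by_contra h
        have h1 : a n = 0 := by
          by_contra h'; exact h (ha (by simp [supp, h']))
        have h2 : b n = 0 := by
          by_contra h'; exact h (hb (by simp [supp, h']))
        simp [supp, h1, h2] at hn
      zero_mem' := by intro n hn; simp [supp] at hn
      smul_mem' := by
        intro c a ha n hn
        apply ha
        simp only [supp, Finset.mem_filter, Finset.mem_univ, true_and, Pi.smul_apply,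
          smul_eq_mul] at hn ⊢
        exact right_ne_zero_of_mul hn }
  let L : (Fin N → ℂ) →ₗ[ℂ] EuclideanSpace ℂ (Fin M) :=
    (WithLp.linearEquiv 2 ℂ (Fin M → ℂ)).symm.toLinearMap ∘ₗ A.mulVecLin
  have hL : ∀ z, l2norm (y - A.mulVec z) = ‖WithLp.toLp 2 y - L z‖ := fun z => rfl
  let W := V.map L
  obtain ⟨z, hz, hzW⟩ := Submodule.mem_map.1 (W.starProjection_apply_mem (WithLp.toLp 2 y))
  refine ⟨z, hz, fun w hw => ?_⟩
  rw [hL, hL, hzW]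
  refine pow_le_pow_left₀ (norm_nonneg _) ?_ 2
  rw [Submodule.starProjection_minimal]
  exact ciInf_le ⟨0, by rintro _ ⟨u, rfl⟩; exact norm_nonneg _⟩
    (⟨L w, Submodule.mem_map_of_mem hw⟩ : W)

/-- A least squares estimate supported in `T`. (Where it is not unique, all of them have the
same image under `A`, so the residual does not depend on the choice.) -/
def lsEstimate {M N : ℕ} (A : Matrix (Fin M) (Fin N) ℂ) (y : Fin M → ℂ) (T : Finset (Fin N)) :
    Fin N → ℂ :=
  (exists_isLeastSquares A y T).choose

/-- A tie-breaking rule for the argmax: given the current active set and a nonempty set of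
maximizers, it names one of the maximizers. -/
def IsTieBreak {N : ℕ} (τ : Finset (Fin N) → Finset (Fin N) → Fin N) : Prop :=
  ∀ T s, s.Nonempty → τ T s ∈ s

/-- The active set `S_t` and the residual `r_t` of orthogonal matching pursuit after `t`
iterations. -/
def omp {M N : ℕ} (τ : Finset (Fin N) → Finset (Fin N) → Fin N)
    (A : Matrix (Fin M) (Fin N) ℂ) (y : Fin M → ℂ) : ℕ → Finset (Fin N) × (Fin M → ℂ)
  | 0 => (∅, y)
  | t + 1 =>
    let T := (omp τ A y t).1
    let r := (omp τ A y t).2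
    let i := τ T (maximizers A r T)
    let T' := insert i T
    (T', y - A.mulVec (lsEstimate A y T'))

/-- The greedy selection condition `‖A_{Sᶜ}^* r‖_∞ < ‖A_S^* r‖_∞`, that is, `ρ(r) < 1`. The
norms are the sup norms of functions on the index sets `Sᶜ` and `S`. -/
def GreedyCondition {M N : ℕ} (A : Matrix (Fin M) (Fin N) ℂ) (S : Finset (Fin N))
    (r : Fin M → ℂ) : Prop :=
  ‖(A.submatrix id (Subtype.val : {n // n ∉ S} → Fin N)).conjTranspose.mulVec r‖ <
    ‖(A.submatrix id (Subtype.val : {n // n ∈ S} → Fin N)).conjTranspose.mulVec r‖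

/-- Successful support detection: `K` iterations of orthogonal matching pursuit on `y = A x`
return exactly the support of `x`, and the greedy selection condition held in each of them. -/
def SSD {M N : ℕ} (τ : Finset (Fin N) → Finset (Fin N) → Fin N)
    (A : Matrix (Fin M) (Fin N) ℂ) (x : Fin N → ℂ) (K : ℕ) : Prop :=
  (omp τ A (A.mulVec x) K).1 = supp x ∧
    ∀ t < K, GreedyCondition A (supp x) (omp τ A (A.mulVec x) t).2

end RPR

end

/-!
If the columns of `A` in the support `S` of `x`, `K` in number, have mutual coherence at most
`1 / K`, then every vector `r` in their span has correlation at least `‖r‖ / K` with one of them.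
A residual of the pursuit started from `A x` is such a vector as long as the active set stays in
`S`, so the pursuit succeeds provided the columns outside `S` all correlate with these residuals
by less than `‖r‖ / K`. Residuals depend on the outside columns through the selection; the pursuit
on the matrix with these columns set to zero removes the dependence, and runs identically as long
as no outside column wins.

Coherences and correlations are thus of the form `|⟨aₙ, r⟩|` with `r` independent of the column
`aₙ`. Given `r`, both the real and the imaginary part are sub-Gaussian with variance proxy
`‖r‖² / (2 M)`, because the law of an entry is invariant under multiplication by `i`. Integrating
the moment generating function against a Gaussian bounds `E exp (l |⟨aₙ, r⟩|²)` for
`l = M / (g ‖r‖²)` by `(1 - 2 / g) ^ (-1 / 2)`, and Markov's inequality at the level `‖r‖ / K` gives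
failure probability at most `(1 - 2 / g) ^ (-1 / 2) * exp (-M / (g K²))`. The factor `N K` counts
at most `K` such events for each of the `N` columns: its coherences with `S` if it lies in `S`, its
correlations with the `K` residuals otherwise.
-/

noncomputable section

namespace RPR

open scoped NNReal ENNReal

section Subgaussian

variable {Ω : Type*} [MeasurableSpace Ω] {P : Measure Ω}

theorem lintegral_exp_mul_sq_gaussianReal {a : ℝ} (ha : 2 * a < 1) :
    ∫⁻ t, ENNReal.ofReal (Real.exp (a * t ^ 2)) ∂(gaussianReal 0 1) =
      ENNReal.ofReal ((1 - 2 * a) ^ (-(1 / 2) : ℝ)) := by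
  have hb : 0 < 1 / 2 - a := by linarith
  have hdensity : ∀ t, gaussianPDFReal 0 1 t * Real.exp (a * t ^ 2) =
      (√(2 * Real.pi))⁻¹ * Real.exp (-(1 / 2 - a) * t ^ 2) := by
    intro t
    rw [gaussianPDFReal, mul_assoc, ← Real.exp_add]
    congr 2
    · simp
    · simp; ring
  rw [gaussianReal_of_var_ne_zero _ one_ne_zero,
    lintegral_withDensity_eq_lintegral_mul _ (measurable_gaussianPDF 0 1) (by fun_prop)]
  simp_rw [Pi.mul_apply, gaussianPDF, ← ENNReal.ofReal_mul (gaussianPDFReal_nonneg _ _ _),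
    hdensity]
  rw [← ofReal_integral_eq_lintegral_ofReal ((integrable_exp_neg_mul_sq hb).const_mul _)
    (.of_forall fun t => by positivity), integral_const_mul, integral_gaussian]
  congr 1
  rw [Real.rpow_neg (by linarith), ← Real.sqrt_eq_rpow, ← Real.sqrt_inv, ← Real.sqrt_inv,
    ← Real.sqrt_mul (by positivity)]
  congr 1
  have : 1 - 2 * a ≠ 0 := by linarith
  field_simp

theorem lintegral_exp_mul_gaussianReal (s : ℝ) :
    ∫⁻ t, ENNReal.ofReal (Real.exp (s * t)) ∂(gaussianReal 0 1) =
      ENNReal.ofReal (Real.exp (s ^ 2 / 2)) := by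
  rw [← ofReal_integral_eq_lintegral_ofReal (integrable_exp_mul_gaussianReal s)
    (.of_forall fun t => by positivity)]
  congr 1
  simpa [mgf] using congrFun (mgf_id_gaussianReal (μ := 0) (v := 1)) s

-- `exp (l X²)` is the average of `exp (√(2l) X t)` over a standard Gaussian `t`; exchanging the
-- two expectations replaces `X` by its moment generating function.
theorem lintegral_exp_mul_sq_le_of_hasSubgaussianMGF [SFinite P] {X : Ω → ℝ} {c : ℝ≥0}
    (hX : HasSubgaussianMGF X c P) {l : ℝ} (hl : 0 ≤ l) (hcl : 2 * (c * l) < 1) :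
    ∫⁻ ω, ENNReal.ofReal (Real.exp (l * X ω ^ 2)) ∂P ≤
      ENNReal.ofReal ((1 - 2 * (c * l)) ^ (-(1 / 2) : ℝ)) := by
  calc ∫⁻ ω, ENNReal.ofReal (Real.exp (l * X ω ^ 2)) ∂P
      = ∫⁻ ω, ∫⁻ t, ENNReal.ofReal (Real.exp (√(2 * l) * X ω * t)) ∂(gaussianReal 0 1) ∂P := by
        refine lintegral_congr fun ω => ?_
        rw [lintegral_exp_mul_gaussianReal, mul_pow, Real.sq_sqrt (by positivity)]
        ring_nf
    _ = ∫⁻ t, ∫⁻ ω, ENNReal.ofReal (Real.exp (√(2 * l) * t * X ω)) ∂P ∂(gaussianReal 0 1) := by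
        rw [lintegral_lintegral_swap ((hX.aemeasurable.comp_fst.const_mul _).mul
          measurable_snd.aemeasurable).exp.ennreal_ofReal]
        simp only [mul_right_comm]
    _ ≤ ∫⁻ t, ENNReal.ofReal (Real.exp (c * l * t ^ 2)) ∂(gaussianReal 0 1) := by
        refine lintegral_mono fun t => ?_
        rw [← ofReal_integral_eq_lintegral_ofReal (hX.integrable_exp_mul _)
          (.of_forall fun _ => by positivity)]
        refine ENNReal.ofReal_le_ofReal ((hX.mgf_le _).trans_eq ?_)
        rw [mul_pow, Real.sq_sqrt (by positivity)]
        ring_nf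
    _ = ENNReal.ofReal ((1 - 2 * (c * l)) ^ (-(1 / 2) : ℝ)) :=
        lintegral_exp_mul_sq_gaussianReal hcl

-- The real and imaginary parts of a random `z` may be dependent; convexity of `exp` separates them.
theorem exp_mul_norm_sq_le (l : ℝ) (z : ℂ) :
    Real.exp (l * ‖z‖ ^ 2) ≤
      2⁻¹ * Real.exp (2 * l * z.re ^ 2) + 2⁻¹ * Real.exp (2 * l * z.im ^ 2) := by
  have hconv := convexOn_exp.2 (Set.mem_univ (2 * l * z.re ^ 2))
    (Set.mem_univ (2 * l * z.im ^ 2)) (by norm_num : (0 : ℝ) ≤ 2⁻¹) (by norm_num : (0 : ℝ) ≤ 2⁻¹)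
    (by norm_num)
  refine le_of_eq_of_le (congrArg Real.exp ?_) hconv
  rw [Complex.sq_norm, Complex.normSq_apply, smul_eq_mul, smul_eq_mul]
  ring

theorem lintegral_exp_mul_norm_sq_le [SFinite P] {Z : Ω → ℂ} {c : ℝ≥0}
    (hre : HasSubgaussianMGF (fun ω => (Z ω).re) c P)
    (him : HasSubgaussianMGF (fun ω => (Z ω).im) c P)
    {l : ℝ} (hl : 0 ≤ l) (hcl : 4 * (c * l) < 1) :
    ∫⁻ ω, ENNReal.ofReal (Real.exp (l * ‖Z ω‖ ^ 2)) ∂P ≤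
      ENNReal.ofReal ((1 - 4 * (c * l)) ^ (-(1 / 2) : ℝ)) := by
  have hcl2 : 2 * (c * (2 * l)) = 4 * (c * l) := by ring
  have hre' := lintegral_exp_mul_sq_le_of_hasSubgaussianMGF hre (l := 2 * l) (by positivity)
    (hcl2 ▸ hcl)
  have him' := lintegral_exp_mul_sq_le_of_hasSubgaussianMGF him (l := 2 * l) (by positivity)
    (hcl2 ▸ hcl)
  rw [hcl2] at hre' him'
  have hrem := hre.aemeasurable
  calc ∫⁻ ω, ENNReal.ofReal (Real.exp (l * ‖Z ω‖ ^ 2)) ∂P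
      ≤ ∫⁻ ω, (2⁻¹ * ENNReal.ofReal (Real.exp (2 * l * (Z ω).re ^ 2)) +
          2⁻¹ * ENNReal.ofReal (Real.exp (2 * l * (Z ω).im ^ 2))) ∂P := by
        refine lintegral_mono fun ω => ?_
        rw [← ENNReal.ofReal_ofNat 2, ← ENNReal.ofReal_inv_of_pos two_pos,
          ← ENNReal.ofReal_mul (by positivity), ← ENNReal.ofReal_mul (by positivity),
          ← ENNReal.ofReal_add (by positivity) (by positivity)]
        exact ENNReal.ofReal_le_ofReal (exp_mul_norm_sq_le l (Z ω))
    _ ≤ 2⁻¹ * ENNReal.ofReal ((1 - 4 * (c * l)) ^ (-(1 / 2) : ℝ)) +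
          2⁻¹ * ENNReal.ofReal ((1 - 4 * (c * l)) ^ (-(1 / 2) : ℝ)) := by
        rw [lintegral_add_left' (by fun_prop), lintegral_const_mul' _ _ (by simp),
          lintegral_const_mul' _ _ (by simp)]
        gcongr
    _ = ENNReal.ofReal ((1 - 4 * (c * l)) ^ (-(1 / 2) : ℝ)) := by
        rw [← add_mul, ENNReal.inv_two_add_inv_two, one_mul]

theorem measure_le_norm_le_of_hasSubgaussianMGF [SFinite P] {Z : Ω → ℂ} {c : ℝ≥0}
    (hre : HasSubgaussianMGF (fun ω => (Z ω).re) c P)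
    (him : HasSubgaussianMGF (fun ω => (Z ω).im) c P)
    {l s : ℝ} (hl : 0 ≤ l) (hcl : 4 * (c * l) < 1) (hs : 0 ≤ s) :
    P {ω | s ≤ ‖Z ω‖} ≤
      ENNReal.ofReal ((1 - 4 * (c * l)) ^ (-(1 / 2) : ℝ) * Real.exp (-(l * s ^ 2))) := by
  have hZm : AEMeasurable Z P := aemeasurable_of_re_im hre.aemeasurable him.aemeasurable
  calc P {ω | s ≤ ‖Z ω‖}
      ≤ P {ω | ENNReal.ofReal (Real.exp (l * s ^ 2)) ≤
          ENNReal.ofReal (Real.exp (l * ‖Z ω‖ ^ 2))} := by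
        refine measure_mono fun ω (hω : s ≤ ‖Z ω‖) => ENNReal.ofReal_le_ofReal ?_
        gcongr
    _ ≤ (∫⁻ ω, ENNReal.ofReal (Real.exp (l * ‖Z ω‖ ^ 2)) ∂P) /
          ENNReal.ofReal (Real.exp (l * s ^ 2)) :=
        meas_ge_le_lintegral_div (by fun_prop) (by simp [Real.exp_pos]) ENNReal.ofReal_ne_top
    _ ≤ ENNReal.ofReal ((1 - 4 * (c * l)) ^ (-(1 / 2) : ℝ)) /
          ENNReal.ofReal (Real.exp (l * s ^ 2)) := by
        gcongr
        exact lintegral_exp_mul_norm_sq_le hre him hl hcl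
    _ = _ := by
        rw [← ENNReal.ofReal_div_of_pos (Real.exp_pos _), Real.exp_neg, div_eq_mul_inv]

theorem cosh_add_cosh_le (c d : ℝ) :
    Real.cosh c + Real.cosh d ≤ 2 * Real.exp ((c ^ 2 + d ^ 2) / 4) := by
  calc Real.cosh c + Real.cosh d
      = 2 * (Real.cosh ((c + d) / 2) * Real.cosh ((c - d) / 2)) := by
        have hadd := Real.cosh_add ((c + d) / 2) ((c - d) / 2)
        have hsub := Real.cosh_sub ((c + d) / 2) ((c - d) / 2)
        rw [show (c + d) / 2 + (c - d) / 2 = c by ring] at hadd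
        rw [show (c + d) / 2 - (c - d) / 2 = d by ring] at hsub
        linarith
    _ ≤ 2 * (Real.exp (((c + d) / 2) ^ 2 / 2) * Real.exp (((c - d) / 2) ^ 2 / 2)) := by
        gcongr <;> exact Real.cosh_le_exp_half_sq _
    _ = 2 * Real.exp ((c ^ 2 + d ^ 2) / 4) := by
        rw [← Real.exp_add]
        ring_nf

end Subgaussian

section QuarterTurn

variable {Ω : Type*} [MeasurableSpace Ω] {P : Measure Ω} [IsProbabilityMeasure P]

theorem integrable_exp_mul_re {W : Ω → ℂ} (hW : AEMeasurable W P) {c : ℝ}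
    (hc : ∀ᵐ ω ∂P, ‖W ω‖ ≤ c) (t : ℝ) : Integrable (fun ω => Real.exp (t * (W ω).re)) P := by
  refine integrable_exp_mul_of_mem_Icc (a := -c) (b := c) (by fun_prop) ?_
  filter_upwards [hc] with ω hω
  exact abs_le.1 ((Complex.abs_re_le_norm _).trans hω)

theorem sum_exp_mul_re_quarter_turns_le (t : ℝ) (z : ℂ) :
    Real.exp (t * z.re) + Real.exp (t * -z.im) + Real.exp (t * -z.re) + Real.exp (t * z.im) ≤
      4 * Real.exp (t ^ 2 * ‖z‖ ^ 2 / 4) := by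
  have h := cosh_add_cosh_le (t * z.re) (t * z.im)
  have hz : (t * z.re) ^ 2 + (t * z.im) ^ 2 = t ^ 2 * ‖z‖ ^ 2 := by
    rw [Complex.sq_norm, Complex.normSq_apply]
    ring
  rw [hz, Real.cosh_eq, Real.cosh_eq] at h
  simp only [mul_neg]
  linarith

-- Averaging over the four quarter turns of `W` turns the exponential into hyperbolic cosines.
theorem mgf_re_le_of_identDistrib_I_mul {W : Ω → ℂ}
    (hW : IdentDistrib (fun ω => Complex.I * W ω) W P P) {c : ℝ} (hc : ∀ᵐ ω ∂P, ‖W ω‖ ≤ c)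
    (t : ℝ) : mgf (fun ω => (W ω).re) P t ≤ Real.exp (t ^ 2 * c ^ 2 / 4) := by
  have hWm : AEMeasurable W P := hW.aemeasurable_snd
  have hturn (a : ℂ) : ∫ ω, Real.exp (t * (a * (Complex.I * W ω)).re) ∂P =
      ∫ ω, Real.exp (t * (a * W ω).re) ∂P :=
    (hW.comp (u := fun z => Real.exp (t * (a * z).re)) (by fun_prop)).integral_eq
  have hint {a : ℂ} (ha : ‖a‖ = 1) : Integrable (fun ω => Real.exp (t * (a * W ω).re)) P :=
    integrable_exp_mul_re (by fun_prop) (by simpa [ha] using hc) t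
  have h₀ := hint (a := 1) (by simp)
  have h₁ := hint (a := Complex.I) (by simp)
  have h₂ := hint (a := -1) (by simp)
  have h₃ := hint (a := -Complex.I) (by simp)
  have e₁ := hturn 1
  have e₂ := hturn Complex.I
  have e₃ := hturn (-1)
  simp only [← mul_assoc, Complex.I_mul_I, one_mul, neg_mul] at e₁ e₂ e₃ h₀ h₁ h₂ h₃
  simp only [Complex.neg_re, Complex.I_mul_re, neg_neg] at e₁ e₂ e₃ h₀ h₁ h₂ h₃
  have hle : ∫ ω, (Real.exp (t * (W ω).re) + Real.exp (t * -(W ω).im) +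
      Real.exp (t * -(W ω).re) + Real.exp (t * (W ω).im)) ∂P ≤
      ∫ _, 4 * Real.exp (t ^ 2 * c ^ 2 / 4) ∂P := by
    refine integral_mono_ae (((h₀.add h₁).add h₂).add h₃) (integrable_const _) ?_
    filter_upwards [hc] with ω hω
    refine (sum_exp_mul_re_quarter_turns_le t (W ω)).trans ?_
    gcongr
  rw [integral_add ((h₀.fun_add h₁).fun_add h₂) h₃, integral_add (h₀.fun_add h₁) h₂,
    integral_add h₀ h₁, integral_const, probReal_univ, one_smul] at hle
  rw [mgf]
  linarith

theorem hasSubgaussianMGF_re_of_identDistrib_I_mul {W : Ω → ℂ}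
    (hW : IdentDistrib (fun ω => Complex.I * W ω) W P P) {c : ℝ≥0} (hc : ∀ᵐ ω ∂P, ‖W ω‖ ≤ c) :
    HasSubgaussianMGF (fun ω => (W ω).re) (c ^ 2 / 2) P where
  integrable_exp_mul := integrable_exp_mul_re hW.aemeasurable_snd hc
  mgf_le t := by
    refine (mgf_re_le_of_identDistrib_I_mul hW hc t).trans_eq ?_
    push_cast
    ring_nf

theorem hasSubgaussianMGF_im_of_identDistrib_I_mul {W : Ω → ℂ}
    (hW : IdentDistrib (fun ω => Complex.I * W ω) W P P) {c : ℝ≥0} (hc : ∀ᵐ ω ∂P, ‖W ω‖ ≤ c) :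
    HasSubgaussianMGF (fun ω => (W ω).im) (c ^ 2 / 2) P :=
  (hasSubgaussianMGF_re_of_identDistrib_I_mul hW hc).congr_identDistrib <| by
    simpa [Function.comp_def] using hW.comp Complex.measurable_im

theorem measure_le_norm_sum_le_of_identDistrib_I_mul {ι : Type*} [Fintype ι] {W : ι → Ω → ℂ}
    (hindep : iIndepFun W P) (hW : ∀ i, IdentDistrib (fun ω => Complex.I * W i ω) (W i) P P)
    {c : ι → ℝ≥0} (hc : ∀ i, ∀ᵐ ω ∂P, ‖W i ω‖ ≤ c i) {l s : ℝ} (hl : 0 ≤ l)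
    (hcl : 2 * (l * ∑ i, (c i : ℝ) ^ 2) < 1) (hs : 0 ≤ s) :
    P {ω | s ≤ ‖∑ i, W i ω‖} ≤ ENNReal.ofReal
      ((1 - 2 * (l * ∑ i, (c i : ℝ) ^ 2)) ^ (-(1 / 2) : ℝ) * Real.exp (-(l * s ^ 2))) := by
  have hre := HasSubgaussianMGF.sum_of_iIndepFun (s := Finset.univ)
    (hindep.comp (fun _ => Complex.re) fun _ => Complex.measurable_re)
    fun i _ => hasSubgaussianMGF_re_of_identDistrib_I_mul (hW i) (hc i)
  have him := HasSubgaussianMGF.sum_of_iIndepFun (s := Finset.univ)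
    (hindep.comp (fun _ => Complex.im) fun _ => Complex.measurable_im)
    fun i _ => hasSubgaussianMGF_im_of_identDistrib_I_mul (hW i) (hc i)
  simp only [Function.comp_apply, ← Complex.re_sum, ← Complex.im_sum] at hre him
  have hsum : 4 * (((∑ i, c i ^ 2 / 2 : ℝ≥0) : ℝ) * l) = 2 * (l * ∑ i, (c i : ℝ) ^ 2) := by
    push_cast
    rw [← Finset.sum_div]
    ring
  rw [← hsum] at hcl ⊢
  exact measure_le_norm_le_of_hasSubgaussianMGF hre him hl hcl hs

end QuarterTurn

theorem map_I_mul_exp_restrict_Ico :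
    (volume.restrict (Set.Ico 0 (2 * Real.pi))).map
        (fun θ : ℝ => Complex.I * Complex.exp (Complex.I * θ)) =
      (volume.restrict (Set.Ico 0 (2 * Real.pi))).map
        (fun θ : ℝ => Complex.exp (Complex.I * θ)) := by
  have : Fact (0 < 2 * Real.pi) := ⟨Real.two_pi_pos⟩
  let e : AddCircle (2 * Real.pi) → ℂ := fun x => AddCircle.toCircle x
  have he : Measurable e := by fun_prop
  have he_mk (θ : ℝ) : e θ = Complex.exp (Complex.I * θ) := by
    simp [e, AddCircle.toCircle_apply_mk, Circle.coe_exp, mul_comm]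
  have he_turn (x : AddCircle (2 * Real.pi)) :
      e (((Real.pi / 2 : ℝ) : AddCircle (2 * Real.pi)) + x) = Complex.I * e x := by
    have hquarter : e ((Real.pi / 2 : ℝ) : AddCircle (2 * Real.pi)) = Complex.I := by
      rw [he_mk, mul_comm]
      simp [Complex.exp_pi_div_two_mul_I]
    rw [← hquarter]
    simp [e, AddCircle.toCircle_add]
  have hmk := AddCircle.measurePreserving_mk (2 * Real.pi) 0
  have hturn := measurePreserving_add_left (volume : Measure (AddCircle (2 * Real.pi)))
    ((Real.pi / 2 : ℝ) : AddCircle (2 * Real.pi))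
  rw [zero_add] at hmk
  simp only [Measure.restrict_congr_set (Ico_ae_eq_Ioc (μ := volume)), ← he_mk, ← he_turn]
  calc _ = (((volume.restrict (Set.Ioc 0 (2 * Real.pi))).map
          (QuotientAddGroup.mk : ℝ → AddCircle (2 * Real.pi))).map
            (((Real.pi / 2 : ℝ) : AddCircle (2 * Real.pi)) + ·)).map e := by
        rw [Measure.map_map hturn.measurable hmk.measurable,
          Measure.map_map he (hturn.measurable.comp hmk.measurable)]
        rfl
    _ = ((volume.restrict (Set.Ioc 0 (2 * Real.pi))).map
          (QuotientAddGroup.mk : ℝ → AddCircle (2 * Real.pi))).map e := by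
        rw [hmk.map_eq, hturn.map_eq]
    _ = _ := Measure.map_map he hmk.measurable

theorem identDistrib_I_mul_exp_of_isUniform {Ω : Type*} [MeasurableSpace Ω] {P : Measure Ω}
    {U : Ω → ℝ} (hU : Measurable U)
    (hunif : pdf.IsUniform U (Set.Ico 0 (2 * Real.pi)) P volume) :
    IdentDistrib (fun ω => Complex.I * Complex.exp (Complex.I * U ω))
      (fun ω => Complex.exp (Complex.I * U ω)) P P where
  aemeasurable_fst := by fun_prop
  aemeasurable_snd := by fun_prop
  map_eq := by
    rw [← Function.comp_def (fun θ : ℝ => Complex.I * Complex.exp (Complex.I * θ)),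
      ← Function.comp_def (fun θ : ℝ => Complex.exp (Complex.I * θ)),
      ← Measure.map_map (by fun_prop) hU, ← Measure.map_map (by fun_prop) hU, hunif,
      ProbabilityTheory.cond, Measure.map_smul, Measure.map_smul, map_I_mul_exp_restrict_Ico]

section Independence

variable {Ω : Type*} [MeasurableSpace Ω] {P : Measure Ω}

theorem measure_prodMk_mem_le_of_indepFun [IsProbabilityMeasure P] {α β : Type*}
    [MeasurableSpace α] [MeasurableSpace β] {U : Ω → α} {V : Ω → β} (hU : Measurable U)
    (hV : Measurable V) (hind : IndepFun U V P) {B : Set (α × β)} (hB : MeasurableSet B) {p : ℝ≥0∞}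
    (hp : ∀ v, P {ω | (U ω, v) ∈ B} ≤ p) : P {ω | (U ω, V ω) ∈ B} ≤ p := by
  have := Measure.isProbabilityMeasure_map hV.aemeasurable (μ := P)
  calc P {ω | (U ω, V ω) ∈ B}
      = (P.map U).prod (P.map V) B := by
        rw [← (indepFun_iff_map_prod_eq_prod_map_map hU.aemeasurable hV.aemeasurable).1 hind,
          Measure.map_apply (hU.prodMk hV) hB]
        rfl
    _ = ∫⁻ v, P {ω | (U ω, v) ∈ B} ∂(P.map V) := by
        rw [Measure.prod_apply_symm hB]
        refine lintegral_congr fun v => ?_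
        rw [Measure.map_apply hU (measurable_prodMk_right hB)]
        rfl
    _ ≤ ∫⁻ _, p ∂(P.map V) := lintegral_mono hp
    _ = p := by simp

theorem indepFun_col_of_iIndepFun {ι κ E : Type*} [Finite ι] [Finite κ] [MeasurableSpace E]
    {X : ι × κ → Ω → E} (hX : ∀ p, Measurable (X p)) (hindep : iIndepFun X P) (k : κ) :
    IndepFun (fun ω i => X (i, k) ω) (fun ω i (j : {j // j ≠ k}) => X (i, j) ω) P := by
  classical
  have := Fintype.ofFinite ι
  have := Fintype.ofFinite κ
  let C : Finset (ι × κ) := {p | p.2 = k}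
  have hdisj : Disjoint C Cᶜ := disjoint_compl_right
  refine (hindep.indepFun_finset C Cᶜ hdisj hX).comp
    (φ := fun v i => v ⟨(i, k), by simp [C]⟩)
    (ψ := fun v i (j : {j // j ≠ k}) => v ⟨(i, j), by simp [C, j.2]⟩) ?_ ?_
  all_goals fun_prop

end Independence

section ColumnTail

variable {Ω : Type*} [MeasurableSpace Ω] {P : Measure Ω} [IsProbabilityMeasure P] {M N : ℕ}
  {A : Ω → Matrix (Fin M) (Fin N) ℂ} {n : Fin N} {g : ℝ}

theorem l2norm_sq (r : Fin M → ℂ) : l2norm r ^ 2 = ∑ m, ‖r m‖ ^ 2 := by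
  simp [l2norm, EuclideanSpace.norm_sq_eq]

theorem l2norm_pos {r : Fin M → ℂ} : 0 < l2norm r ↔ r ≠ 0 := by
  simp [l2norm]

theorem measurable_l2norm : Measurable (l2norm : (Fin M → ℂ) → ℝ) := by
  unfold l2norm
  fun_prop

theorem corr_eq_norm_sum (B : Matrix (Fin M) (Fin N) ℂ) (r : Fin M → ℂ) (n : Fin N) :
    corr B r n = ‖∑ m, B m n * star (r m)‖ := by
  rw [corr, ← norm_star]
  simp [dotProduct, mul_comm]

theorem measure_l2norm_div_le_corr_le (hg : 2 < g)
    (hnorm : ∀ m, ∀ᵐ ω ∂P, ‖A ω m n‖ ≤ 1 / √M)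
    (hrot : ∀ m, IdentDistrib (fun ω => Complex.I * A ω m n) (fun ω => A ω m n) P P)
    (hindep : iIndepFun (fun m ω => A ω m n) P) {s : ℝ} (hs : 0 ≤ s) {r : Fin M → ℂ}
    (hr : r ≠ 0) :
    P {ω | l2norm r / s ≤ corr (A ω) r n} ≤
      ENNReal.ofReal ((1 - 2 / g) ^ (-(1 / 2) : ℝ) * Real.exp (-(M / (g * s ^ 2)))) := by
  have hrpos : 0 < l2norm r := l2norm_pos.2 hr
  have hM : (0 : ℝ) < M := by
    obtain ⟨m, -⟩ := Function.ne_iff.1 hr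
    exact_mod_cast m.pos
  let l : ℝ := M / (g * l2norm r ^ 2)
  let c : Fin M → ℝ≥0 := fun m => ⟨1 / √M * ‖r m‖, by positivity⟩
  have hc (m : Fin M) : (c m : ℝ) = 1 / √M * ‖r m‖ := rfl
  have hvar : 2 * (l * ∑ m, (c m : ℝ) ^ 2) = 2 / g := by
    calc 2 * (l * ∑ m, (c m : ℝ) ^ 2)
        = 2 * (l * ((1 / √M) ^ 2 * l2norm r ^ 2)) := by
          simp only [hc, mul_pow, l2norm_sq, Finset.mul_sum]
      _ = 2 / g := by
          rw [div_pow, Real.sq_sqrt hM.le]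
          simp only [l]
          field_simp
  have hexp : l * (l2norm r / s) ^ 2 = M / (g * s ^ 2) := by
    simp only [l]
    field_simp
  have htail := measure_le_norm_sum_le_of_identDistrib_I_mul
    (W := fun m ω => A ω m n * star (r m)) (c := c)
    (hindep.comp (fun m z => z * star (r m)) fun m => by fun_prop)
    (fun m => by simpa [mul_assoc] using (hrot m).mul_const (star (r m)))
    (fun m => (hnorm m).mono fun ω hω => by
      rw [norm_mul, norm_star]
      exact mul_le_mul_of_nonneg_right hω (norm_nonneg _))
    (l := l) (s := l2norm r / s) (by positivity)
    (by rw [hvar]; exact (div_lt_one (by positivity)).2 hg) (by positivity)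
  simpa only [hvar, hexp, corr_eq_norm_sum] using htail

theorem measure_l2norm_div_le_corr_le_of_indepFun (hA : ∀ m, Measurable fun ω => A ω m n)
    (hg : 2 < g) (hnorm : ∀ m, ∀ᵐ ω ∂P, ‖A ω m n‖ ≤ 1 / √M)
    (hrot : ∀ m, IdentDistrib (fun ω => Complex.I * A ω m n) (fun ω => A ω m n) P P)
    (hindep : iIndepFun (fun m ω => A ω m n) P) {s : ℝ} (hs : 0 ≤ s) {r : Ω → Fin M → ℂ}
    (hr : Measurable r) (hind : IndepFun (fun ω m => A ω m n) r P) :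
    P {ω | r ω ≠ 0 ∧ l2norm (r ω) / s ≤ corr (A ω) (r ω) n} ≤
      ENNReal.ofReal ((1 - 2 / g) ^ (-(1 / 2) : ℝ) * Real.exp (-(M / (g * s ^ 2)))) := by
  let B : Set ((Fin M → ℂ) × (Fin M → ℂ)) :=
    {p | p.2 ≠ 0 ∧ l2norm p.2 / s ≤ ‖∑ m, p.1 m * star (p.2 m)‖}
  have hB : MeasurableSet B :=
    (measurable_snd (measurableSet_singleton 0)).compl.inter <|
      measurableSet_le ((measurable_l2norm.comp measurable_snd).div_const s) (by fun_prop)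
  have hmem (ω : Ω) (v : Fin M → ℂ) : (fun m => A ω m n, v) ∈ B ↔
      v ≠ 0 ∧ l2norm v / s ≤ corr (A ω) v n := by
    simp only [B, Set.mem_ofPred_eq, corr_eq_norm_sum]
  simp only [← hmem]
  refine measure_prodMk_mem_le_of_indepFun (measurable_pi_lambda _ hA) hr hind hB fun v => ?_
  by_cases hv : v = 0
  · simp [hmem, hv]
  · simpa [hmem, hv] using measure_l2norm_div_le_corr_le hg hnorm hrot hindep hs hv

end ColumnTail

section Coherence

variable {𝕜 E ι : Type*} [RCLike 𝕜] [NormedAddCommGroup E] [InnerProductSpace 𝕜 E]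
  {a : ι → E} {S : Finset ι}

theorem norm_sum_smul_sq_ge_of_pairwise_norm_inner_le (hunit : ∀ i ∈ S, ‖a i‖ = 1) {μ : ℝ}
    (hcoh : (S : Set ι).Pairwise fun i k => ‖inner 𝕜 (a i) (a k)‖ ≤ μ) (c : ι → 𝕜) :
    (1 + μ) * ∑ i ∈ S, ‖c i‖ ^ 2 - μ * (∑ i ∈ S, ‖c i‖) ^ 2 ≤ ‖∑ i ∈ S, c i • a i‖ ^ 2 := by
  classical
  have hterm : ∀ i ∈ S, ∀ k ∈ S,
      (if i = k then (1 + μ) * ‖c i‖ ^ 2 else 0) - μ * (‖c i‖ * ‖c k‖) ≤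
        RCLike.re (inner 𝕜 (c i • a i) (c k • a k)) := by
    intro i hi k hk
    split_ifs with hik
    · subst hik
      rw [inner_self_eq_norm_sq, norm_smul, hunit i hi]
      exact le_of_eq (by ring)
    · have hnorm : ‖inner 𝕜 (c i • a i) (c k • a k)‖ ≤ μ * (‖c i‖ * ‖c k‖) := by
        rw [inner_smul_left, inner_smul_right, norm_mul, norm_mul, RCLike.norm_conj, ← mul_assoc,
          mul_comm]
        exact mul_le_mul_of_nonneg_right (hcoh hi hk hik) (by positivity)
      linarith [(abs_le.1 ((RCLike.abs_re_le_norm _).trans hnorm)).1]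
  calc (1 + μ) * ∑ i ∈ S, ‖c i‖ ^ 2 - μ * (∑ i ∈ S, ‖c i‖) ^ 2
      = ∑ i ∈ S, ∑ k ∈ S,
          ((if i = k then (1 + μ) * ‖c i‖ ^ 2 else 0) - μ * (‖c i‖ * ‖c k‖)) := by
        rw [sq (∑ i ∈ S, ‖c i‖), Finset.sum_mul_sum]
        simp only [Finset.sum_sub_distrib, Finset.sum_ite_eq, Finset.mul_sum, Finset.sum_ite_mem,
          Finset.inter_self]
    _ ≤ ∑ i ∈ S, ∑ k ∈ S, RCLike.re (inner 𝕜 (c i • a i) (c k • a k)) :=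
        Finset.sum_le_sum fun i hi => Finset.sum_le_sum fun k hk => hterm i hi k hk
    _ = ‖∑ i ∈ S, c i • a i‖ ^ 2 := by
        rw [← inner_self_eq_norm_sq (𝕜 := 𝕜), sum_inner]
        simp only [inner_sum, map_sum]

theorem sum_norm_le_card_mul_norm_sum_smul (hunit : ∀ i ∈ S, ‖a i‖ = 1)
    (hcoh : (S : Set ι).Pairwise fun i k => ‖inner 𝕜 (a i) (a k)‖ ≤ 1 / S.card) (c : ι → 𝕜) :
    ∑ i ∈ S, ‖c i‖ ≤ S.card * ‖∑ i ∈ S, c i • a i‖ := by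
  rcases S.eq_empty_or_nonempty with rfl | hS
  · simp
  have hgram := norm_sum_smul_sq_ge_of_pairwise_norm_inner_le hunit hcoh c
  have hcauchy : (∑ i ∈ S, ‖c i‖) ^ 2 ≤ S.card * ∑ i ∈ S, ‖c i‖ ^ 2 := sq_sum_le_card_mul_sum_sq
  refine le_of_sq_le_sq ?_ (by positivity)
  calc (∑ i ∈ S, ‖c i‖) ^ 2
      ≤ (S.card + 1) * (S.card * ∑ i ∈ S, ‖c i‖ ^ 2) - S.card * (∑ i ∈ S, ‖c i‖) ^ 2 := by
        linarith [mul_le_mul_of_nonneg_left hcauchy (by positivity : (0 : ℝ) ≤ S.card + 1)]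
    _ = S.card ^ 2 * ((1 + 1 / S.card) * ∑ i ∈ S, ‖c i‖ ^ 2 -
          1 / S.card * (∑ i ∈ S, ‖c i‖) ^ 2) := by
        field_simp
    _ ≤ S.card ^ 2 * ‖∑ i ∈ S, c i • a i‖ ^ 2 := by gcongr
    _ = (S.card * ‖∑ i ∈ S, c i • a i‖) ^ 2 := (mul_pow _ _ _).symm

theorem exists_norm_sum_smul_div_card_le_norm_inner (hunit : ∀ i ∈ S, ‖a i‖ = 1)
    (hcoh : (S : Set ι).Pairwise fun i k => ‖inner 𝕜 (a i) (a k)‖ ≤ 1 / S.card)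
    (hS : S.Nonempty) (c : ι → 𝕜) :
    ∃ i ∈ S, ‖∑ k ∈ S, c k • a k‖ / S.card ≤ ‖inner 𝕜 (a i) (∑ k ∈ S, c k • a k)‖ := by
  set u := ∑ k ∈ S, c k • a k with hu
  obtain ⟨i, hi, hmax⟩ := S.exists_max_image (fun i => ‖inner 𝕜 (a i) u‖) hS
  refine ⟨i, hi, ?_⟩
  have hK : (0 : ℝ) < S.card := by exact_mod_cast hS.card_pos
  rcases (norm_nonneg u).eq_or_lt with hzero | hpos
  · simp [← hzero]
  rw [div_le_iff₀' hK]
  refine le_of_mul_le_mul_left ?_ hpos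
  calc ‖u‖ * ‖u‖ = ‖∑ k ∈ S, starRingEnd 𝕜 (c k) * inner 𝕜 (a k) u‖ := by
        rw [← sq]
        simp only [← inner_smul_left, ← sum_inner, ← hu, inner_self_eq_norm_sq_to_K, norm_pow,
          RCLike.norm_ofReal, abs_norm]
    _ ≤ ∑ k ∈ S, ‖c k‖ * ‖inner 𝕜 (a k) u‖ :=
        norm_sum_le_of_le _ fun k _ => by rw [norm_mul, RCLike.norm_conj]
    _ ≤ ∑ k ∈ S, ‖c k‖ * ‖inner 𝕜 (a i) u‖ := by
        gcongr with k hk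
        exact hmax k hk
    _ ≤ (S.card * ‖u‖) * ‖inner 𝕜 (a i) u‖ := by
        rw [← Finset.sum_mul]
        gcongr
        exact sum_norm_le_card_mul_norm_sum_smul hunit hcoh c
    _ = ‖u‖ * (S.card * ‖inner 𝕜 (a i) u‖) := by ring

end Coherence

section ResidualProj

variable {𝕜 E ι : Type*} [RCLike 𝕜] [NormedAddCommGroup E] [InnerProductSpace 𝕜 E]
  [FiniteDimensional 𝕜 E] {a : ι → E} {S : Finset ι} {T : Set ι}

variable (𝕜) in
/-- The orthogonal projection along the span of the vectors `a i`, `i ∈ T`: it sends a vector to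
the residual of its least squares approximation by these vectors. -/
def residualProj (a : ι → E) (T : Set ι) : E →L[𝕜] E :=
  (Submodule.span 𝕜 (a '' T))ᗮ.starProjection

theorem residualProj_congr {b : ι → E} (hab : Set.EqOn a b T) :
    residualProj 𝕜 a T = residualProj 𝕜 b T := by
  simp only [residualProj, hab.image_eq]

theorem residualProj_mem_orthogonal (u : E) :
    residualProj 𝕜 a T u ∈ (Submodule.span 𝕜 (a '' T))ᗮ :=
  Submodule.starProjection_apply_mem _ u

theorem sub_residualProj_mem_span (u : E) :
    u - residualProj 𝕜 a T u ∈ Submodule.span 𝕜 (a '' T) := by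
  rw [residualProj, Submodule.starProjection_orthogonal_val, sub_sub_cancel]
  exact Submodule.starProjection_apply_mem _ u

theorem residualProj_eq_of_mem_orthogonal {u v : E}
    (hv : v ∈ (Submodule.span 𝕜 (a '' T))ᗮ) (huv : u - v ∈ Submodule.span 𝕜 (a '' T)) :
    residualProj 𝕜 a T u = v :=
  (Submodule.eq_starProjection_of_mem_orthogonal hv
    (Submodule.le_orthogonal_orthogonal _ huv))

theorem inner_residualProj_eq_zero {i : ι} (hi : i ∈ T) (u : E) :
    inner 𝕜 (a i) (residualProj 𝕜 a T u) = 0 :=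
  residualProj_mem_orthogonal u _ (Submodule.subset_span ⟨i, hi, rfl⟩)

theorem residualProj_empty (u : E) : residualProj 𝕜 a ∅ u = u :=
  residualProj_eq_of_mem_orthogonal (by simp) (by simp)

theorem exists_residualProj_sum_smul_eq {T : Finset ι} (hTS : T ⊆ S) (x : ι → 𝕜) :
    ∃ c : ι → 𝕜, (∀ j ∉ T, c j = x j) ∧
      residualProj 𝕜 a T (∑ i ∈ S, x i • a i) = ∑ i ∈ S, c i • a i := by
  classical
  obtain ⟨z, hz⟩ := (Submodule.mem_span_image_finset_iff_exists_fun' 𝕜).1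
    (sub_residualProj_mem_span (T := (T : Set ι)) (𝕜 := 𝕜) (a := a) (∑ i ∈ S, x i • a i))
  refine ⟨fun i => x i - if i ∈ T then z i else 0, fun j hj => by simp [hj], ?_⟩
  simp only [sub_smul, Finset.sum_sub_distrib, ite_smul, zero_smul, Finset.sum_ite_mem,
    Finset.inter_eq_right.2 hTS, hz, sub_sub_cancel]

-- One step of Gram–Schmidt. If `a n` already lies in the span, the coefficient is
-- `0 / 0 = 0`, and no correction is made.
theorem residualProj_insert (n : ι) (u : E) :
    residualProj 𝕜 a (insert n T) u = residualProj 𝕜 a T u -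
      (inner 𝕜 (residualProj 𝕜 a T (a n)) (residualProj 𝕜 a T u) /
        (‖residualProj 𝕜 a T (a n)‖ : 𝕜) ^ 2) • residualProj 𝕜 a T (a n) := by
  set w := residualProj 𝕜 a T (a n)
  set r := residualProj 𝕜 a T u
  set c := inner 𝕜 w r / (‖w‖ : 𝕜) ^ 2 with hc
  have hw_span : a n - w ∈ Submodule.span 𝕜 (a '' T) := sub_residualProj_mem_span (a n)
  have hr_span : u - r ∈ Submodule.span 𝕜 (a '' T) := sub_residualProj_mem_span u
  have hv : r - c • w ∈ (Submodule.span 𝕜 (a '' T))ᗮ :=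
    sub_mem (residualProj_mem_orthogonal u)
      (Submodule.smul_mem _ c (residualProj_mem_orthogonal (a n)))
  have hwv : inner 𝕜 w (r - c • w) = 0 := by
    rcases eq_or_ne w 0 with hw0 | hw0
    · rw [hw0, inner_zero_left]
    · have : (‖w‖ : 𝕜) ≠ 0 := by exact_mod_cast norm_ne_zero_iff.2 hw0
      rw [inner_sub_right, inner_smul_right, inner_self_eq_norm_sq_to_K, hc]
      field_simp
      ring
  have hle : Submodule.span 𝕜 (a '' T) ≤ Submodule.span 𝕜 (a '' insert n T) :=
    Submodule.span_mono (Set.image_mono (Set.subset_insert n T))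
  have han : a n ∈ Submodule.span 𝕜 (a '' insert n T) :=
    Submodule.subset_span ⟨n, Set.mem_insert n T, rfl⟩
  refine residualProj_eq_of_mem_orthogonal ?_ ?_
  · rw [Set.image_insert_eq, Submodule.span_insert, ← Submodule.inf_orthogonal]
    refine ⟨Submodule.mem_orthogonal_singleton_iff_inner_right.2 ?_, hv⟩
    rw [← sub_add_cancel (a n) w, inner_add_left, hwv, hv _ hw_span, add_zero]
  · have : u - (r - c • w) = (u - r) + c • (a n - (a n - w)) := by
      rw [sub_sub_cancel]; abel
    rw [this]
    exact add_mem (hle hr_span) (Submodule.smul_mem _ c (sub_mem han (hle hw_span)))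

theorem measurable_residualProj {α : Type*} [MeasurableSpace α] [MeasurableSpace E] [BorelSpace E]
    {a : α → ι → E} (ha : ∀ i, Measurable fun ω => a ω i) (T : Finset ι) {u : α → E}
    (hu : Measurable u) : Measurable fun ω => residualProj 𝕜 (a ω) T (u ω) := by
  classical
  have := FiniteDimensional.proper_rclike 𝕜 E
  induction T using Finset.induction_on generalizing u with
  | empty => simpa only [Finset.coe_empty, residualProj_empty] using hu
  | insert n T _ ih =>
    simp only [Finset.coe_insert, residualProj_insert]
    fun_prop

end ResidualProj

section LeastSquares

variable {M N : ℕ} {A : Matrix (Fin M) (Fin N) ℂ}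

/-- The `n`-th column of `A` as a vector of Euclidean space, where columns have the `ℓ²` norm. -/
def euclideanCol (A : Matrix (Fin M) (Fin N) ℂ) (n : Fin N) : EuclideanSpace ℂ (Fin M) :=
  WithLp.toLp 2 (A.col n)

theorem corr_eq_norm_inner (A : Matrix (Fin M) (Fin N) ℂ) (r : Fin M → ℂ) (n : Fin N) :
    corr A r n = ‖inner ℂ (euclideanCol A n) (WithLp.toLp 2 r)‖ := by
  rw [corr, euclideanCol, EuclideanSpace.inner_toLp_toLp, dotProduct_comm]

theorem mem_supp {x : Fin N → ℂ} {n : Fin N} : n ∈ supp x ↔ x n ≠ 0 := by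
  simp [supp]

theorem supp_subset_iff {z : Fin N → ℂ} {T : Finset (Fin N)} :
    supp z ⊆ T ↔ ∀ n ∉ T, z n = 0 := by
  simp only [Finset.subset_iff, mem_supp, not_imp_comm, ne_eq]

theorem toLp_mulVec (A : Matrix (Fin M) (Fin N) ℂ) {T : Finset (Fin N)} {z : Fin N → ℂ}
    (hz : supp z ⊆ T) : WithLp.toLp 2 (A.mulVec z) = ∑ n ∈ T, z n • euclideanCol A n := by
  have hsum : ∑ n ∈ T, z n • euclideanCol A n = ∑ n, z n • euclideanCol A n :=
    Finset.sum_subset T.subset_univ fun n _ hn => by rw [supp_subset_iff.1 hz n hn, zero_smul]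
  rw [hsum]
  ext m
  simp [euclideanCol, Matrix.mulVec, dotProduct, mul_comm]

theorem mem_span_euclideanCol_iff {T : Finset (Fin N)} {u : EuclideanSpace ℂ (Fin M)} :
    u ∈ Submodule.span ℂ (euclideanCol A '' T) ↔
      ∃ z, supp z ⊆ T ∧ WithLp.toLp 2 (A.mulVec z) = u := by
  constructor
  · rw [Submodule.mem_span_image_finset_iff_exists_fun' ℂ]
    rintro ⟨c, rfl⟩
    have hsupp : supp (fun n => if n ∈ T then c n else 0) ⊆ T :=
      supp_subset_iff.2 fun n hn => if_neg hn
    refine ⟨_, hsupp, ?_⟩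
    rw [toLp_mulVec A hsupp]
    exact Finset.sum_congr rfl fun n hn => by rw [if_pos hn]
  · rintro ⟨z, hz, rfl⟩
    rw [toLp_mulVec A hz]
    exact Submodule.sum_mem _ fun n hn =>
      Submodule.smul_mem _ _ (Submodule.subset_span ⟨n, hn, rfl⟩)

theorem IsLeastSquares.toLp_residual {y : Fin M → ℂ} {T : Finset (Fin N)} {z : Fin N → ℂ}
    (hz : IsLeastSquares A y T z) :
    WithLp.toLp 2 (y - A.mulVec z) = residualProj ℂ (euclideanCol A) T (WithLp.toLp 2 y) := by
  set V := Submodule.span ℂ (euclideanCol A '' T)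
  have hmem : WithLp.toLp 2 (A.mulVec z) ∈ V := mem_span_euclideanCol_iff.2 ⟨z, hz.1, rfl⟩
  have hmin : ‖WithLp.toLp 2 y - WithLp.toLp 2 (A.mulVec z)‖ =
      ⨅ w : V, ‖WithLp.toLp 2 y - (w : EuclideanSpace ℂ (Fin M))‖ := by
    refine le_antisymm (le_ciInf fun w => ?_)
      (ciInf_le ⟨0, by rintro _ ⟨u, rfl⟩; exact norm_nonneg _⟩ (⟨_, hmem⟩ : V))
    obtain ⟨w', hw', hw⟩ := mem_span_euclideanCol_iff.1 w.2
    rw [← hw]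
    exact le_of_sq_le_sq (hz.2 w' hw') (norm_nonneg _)
  symm
  refine residualProj_eq_of_mem_orthogonal ?_ (by simpa using hmem)
  rw [Submodule.mem_orthogonal']
  exact (Submodule.norm_eq_iInf_iff_inner_eq_zero V hmem).1 hmin

theorem toLp_omp_snd (τ : Finset (Fin N) → Finset (Fin N) → Fin N)
    (A : Matrix (Fin M) (Fin N) ℂ) (y : Fin M → ℂ) (t : ℕ) :
    WithLp.toLp 2 (omp τ A y t).2 =
      residualProj ℂ (euclideanCol A) (omp τ A y t).1 (WithLp.toLp 2 y) := by
  cases t with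
  | zero => simp only [omp, Finset.coe_empty, residualProj_empty]
  | succ t => exact (exists_isLeastSquares A y _).choose_spec.toLp_residual

end LeastSquares

section GreedySelection

variable {M N : ℕ} {A : Matrix (Fin M) (Fin N) ℂ} {S T : Finset (Fin N)} {r : Fin M → ℂ}
  {n : Fin N}

/-- The matrix `A` with the columns outside `S` set to zero. The pursuit run on it serves as a
reference that does not depend on the columns outside `S`. -/
def restrictCols (S : Finset (Fin N)) (A : Matrix (Fin M) (Fin N) ℂ) :
    Matrix (Fin M) (Fin N) ℂ :=
  Matrix.of fun m n => if n ∈ S then A m n else 0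

theorem restrictCols_mulVec (A : Matrix (Fin M) (Fin N) ℂ) {z : Fin N → ℂ} (hz : supp z ⊆ S) :
    (restrictCols S A).mulVec z = A.mulVec z := by
  ext m
  simp only [Matrix.mulVec, dotProduct]
  refine Finset.sum_congr rfl fun n _ => ?_
  by_cases hn : n ∈ S
  · simp [restrictCols, hn]
  · simp [supp_subset_iff.1 hz n hn]

theorem euclideanCol_restrictCols_of_mem (A : Matrix (Fin M) (Fin N) ℂ) (hn : n ∈ S) :
    euclideanCol (restrictCols S A) n = euclideanCol A n := by
  ext m
  simp [euclideanCol, restrictCols, hn]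

theorem residualProj_euclideanCol_restrictCols (A : Matrix (Fin M) (Fin N) ℂ) (hTS : T ⊆ S) :
    residualProj ℂ (euclideanCol (restrictCols S A)) T = residualProj ℂ (euclideanCol A) T :=
  residualProj_congr fun _ hn => euclideanCol_restrictCols_of_mem A (hTS hn)

theorem corr_restrictCols_of_mem (A : Matrix (Fin M) (Fin N) ℂ) (r : Fin M → ℂ) (hn : n ∈ S) :
    corr (restrictCols S A) r n = corr A r n := by
  rw [corr_eq_norm_inner, corr_eq_norm_inner, euclideanCol_restrictCols_of_mem A hn]

theorem corr_restrictCols_of_notMem (A : Matrix (Fin M) (Fin N) ℂ) (r : Fin M → ℂ)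
    (hn : n ∉ S) : corr (restrictCols S A) r n = 0 := by
  simp [corr_eq_norm_sum, restrictCols, hn]

theorem mem_maximizers :
    n ∈ maximizers A r T ↔ n ∉ T ∧ ∀ k ∉ T, corr A r k ≤ corr A r n := by
  simp [maximizers]

theorem maximizers_nonempty (A : Matrix (Fin M) (Fin N) ℂ) (r : Fin M → ℂ) (hn : n ∉ T) :
    (maximizers A r T).Nonempty := by
  obtain ⟨i, hi, hmax⟩ := Tᶜ.exists_max_image (corr A r) ⟨n, Finset.mem_compl.2 hn⟩
  exact ⟨i, mem_maximizers.2 ⟨Finset.mem_compl.1 hi, fun k hk => hmax k (Finset.mem_compl.2 hk)⟩⟩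

/-- Some column of `S` not yet in the active set `T` correlates with the residual `r` strictly
more than every column outside `S`, so that the next greedy choice falls into `S`. -/
def FavorsSupport (A : Matrix (Fin M) (Fin N) ℂ) (S T : Finset (Fin N)) (r : Fin M → ℂ) : Prop :=
  ∃ i ∈ S, i ∉ T ∧ 0 < corr A r i ∧ ∀ n ∉ S, corr A r n < corr A r i

namespace FavorsSupport

theorem restrictCols (h : FavorsSupport A S T r) :
    FavorsSupport (restrictCols S A) S T r := by
  obtain ⟨i, hiS, hiT, hpos, -⟩ := h
  have hpos' : 0 < corr (RPR.restrictCols S A) r i := by rwa [corr_restrictCols_of_mem A r hiS]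
  exact ⟨i, hiS, hiT, hpos', fun n hn => by rwa [corr_restrictCols_of_notMem A r hn]⟩

theorem mem_maximizers_iff (h : FavorsSupport A S T r) :
    n ∈ maximizers A r T ↔ n ∈ S ∧ n ∉ T ∧ ∀ k ∈ S, k ∉ T → corr A r k ≤ corr A r n := by
  obtain ⟨i, hiS, hiT, -, hlt⟩ := h
  rw [mem_maximizers]
  constructor
  · rintro ⟨hnT, hmax⟩
    exact ⟨by_contra fun hnS => (hmax i hiT).not_gt (hlt n hnS), hnT, fun k _ => hmax k⟩
  · rintro ⟨-, hnT, hmax⟩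
    refine ⟨hnT, fun k hkT => ?_⟩
    by_cases hkS : k ∈ S
    · exact hmax k hkS hkT
    · exact (hlt k hkS).le.trans (hmax i hiS hiT)

theorem maximizers_restrictCols (h : FavorsSupport A S T r) :
    maximizers (RPR.restrictCols S A) r T = maximizers A r T := by
  ext n
  rw [h.mem_maximizers_iff, h.restrictCols.mem_maximizers_iff]
  refine and_congr_right fun hnS => and_congr_right fun _ => forall₂_congr fun k hkS => ?_
  rw [corr_restrictCols_of_mem A r hnS, corr_restrictCols_of_mem A r hkS]

theorem tieBreak_mem_sdiff {τ : Finset (Fin N) → Finset (Fin N) → Fin N} (hτ : IsTieBreak τ)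
    (h : FavorsSupport A S T r) : τ T (maximizers A r T) ∈ S \ T := by
  obtain ⟨i, -, hiT, -⟩ := id h
  obtain ⟨hS, hT, -⟩ := h.mem_maximizers_iff.1 (hτ T _ (maximizers_nonempty A r hiT))
  exact Finset.mem_sdiff.2 ⟨hS, hT⟩

theorem greedyCondition (h : FavorsSupport A S T r) : GreedyCondition A S r := by
  obtain ⟨i, hiS, -, hpos, hlt⟩ := h
  refine lt_of_lt_of_le ((pi_norm_lt_iff hpos).2 fun n => hlt n n.2) ?_
  exact norm_le_pi_norm
    ((A.submatrix id (Subtype.val : {n // n ∈ S} → Fin N)).conjTranspose.mulVec r) ⟨i, hiS⟩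

end FavorsSupport

theorem omp_eq_omp_restrictCols {τ : Finset (Fin N) → Finset (Fin N) → Fin N}
    (hτ : IsTieBreak τ) {y : Fin M → ℂ} {k : ℕ}
    (hfav : ∀ t < k, (omp τ (restrictCols S A) y t).1 ⊆ S →
      (omp τ (restrictCols S A) y t).1.card = t →
      FavorsSupport A S (omp τ (restrictCols S A) y t).1 (omp τ (restrictCols S A) y t).2) :
    ∀ t ≤ k, omp τ A y t = omp τ (restrictCols S A) y t ∧
      (omp τ (restrictCols S A) y t).1 ⊆ S ∧ (omp τ (restrictCols S A) y t).1.card = t := by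
  intro t ht
  induction t with
  | zero => simp [omp]
  | succ t ih =>
    obtain ⟨heq, hsub, hcard⟩ := ih (by lia)
    have h := hfav t ht hsub hcard
    obtain ⟨hS, hT⟩ := Finset.mem_sdiff.1 (h.restrictCols.tieBreak_mem_sdiff hτ)
    have hfst : (omp τ A y (t + 1)).1 = (omp τ (restrictCols S A) y (t + 1)).1 := by
      simp only [omp, heq, h.maximizers_restrictCols]
    have hsub' : (omp τ (restrictCols S A) y (t + 1)).1 ⊆ S := Finset.insert_subset hS hsub
    refine ⟨Prod.ext hfst (WithLp.toLp_injective 2 ?_), hsub', ?_⟩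
    · rw [toLp_omp_snd, toLp_omp_snd, hfst, residualProj_euclideanCol_restrictCols A hsub']
    · exact (Finset.card_insert_of_notMem hT).trans (congrArg (· + 1) hcard)

theorem favorsSupport_of_coherence {x : Fin N → ℂ} (hunit : ∀ i ∈ supp x, ‖euclideanCol A i‖ = 1)
    (hcoh : (supp x : Set (Fin N)).Pairwise fun i k =>
      ‖inner ℂ (euclideanCol A i) (euclideanCol A k)‖ ≤ 1 / (supp x).card)
    (hTS : T ⊆ supp x) (hcard : T.card < (supp x).card)
    (hr : WithLp.toLp 2 r = residualProj ℂ (euclideanCol A) T (WithLp.toLp 2 (A.mulVec x)))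
    (hout : r ≠ 0 → ∀ n ∉ supp x, corr A r n < l2norm r / (supp x).card) :
    FavorsSupport A (supp x) T r := by
  have hK : (0 : ℝ) < (supp x).card := by exact_mod_cast (Nat.zero_le _).trans_lt hcard
  obtain ⟨j, hjS, hjT⟩ := Finset.exists_mem_notMem_of_card_lt_card hcard
  obtain ⟨c, hcx, hc⟩ := exists_residualProj_sum_smul_eq (a := euclideanCol A) hTS x
  rw [toLp_mulVec A subset_rfl, hc] at hr
  have hrpos : 0 < l2norm r := by
    have hsum : 0 < ∑ i ∈ supp x, ‖c i‖ :=
      Finset.sum_pos' (fun _ _ => norm_nonneg _)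
        ⟨j, hjS, norm_pos_iff.2 (by rw [hcx j hjT]; exact mem_supp.1 hjS)⟩
    have hle := sum_norm_le_card_mul_norm_sum_smul hunit hcoh c
    rw [← hr] at hle
    exact pos_of_mul_pos_right (hsum.trans_le hle) hK.le
  obtain ⟨i, hiS, hi⟩ :=
    exists_norm_sum_smul_div_card_le_norm_inner hunit hcoh ⟨j, hjS⟩ c
  rw [← hr, ← corr_eq_norm_inner] at hi
  have hpos : 0 < corr A r i := (div_pos hrpos hK).trans_le hi
  refine ⟨i, hiS, fun hiT => hpos.ne' ?_, hpos, fun n hn =>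
    (hout (l2norm_pos.1 hrpos) n hn).trans_le hi⟩
  rw [corr_eq_norm_inner, hr, ← hc, inner_residualProj_eq_zero (by exact_mod_cast hiT), norm_zero]

theorem ssd_of_coherence {τ : Finset (Fin N) → Finset (Fin N) → Fin N} (hτ : IsTieBreak τ)
    {x : Fin N → ℂ} (hunit : ∀ i ∈ supp x, ‖euclideanCol A i‖ = 1)
    (hcoh : (supp x : Set (Fin N)).Pairwise fun i k =>
      ‖inner ℂ (euclideanCol A i) (euclideanCol A k)‖ ≤ 1 / (supp x).card)
    (hout : ∀ t < (supp x).card, ∀ r,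
      r = (omp τ (restrictCols (supp x) A) ((restrictCols (supp x) A).mulVec x) t).2 →
      r ≠ 0 → ∀ n ∉ supp x, corr A r n < l2norm r / (supp x).card) :
    SSD τ A x (supp x).card := by
  have hAx := restrictCols_mulVec A (S := supp x) subset_rfl
  rw [hAx] at hout
  set y := A.mulVec x
  set B := restrictCols (supp x) A
  have hfav (t : ℕ) (ht : t < (supp x).card) (hsub : (omp τ B y t).1 ⊆ supp x)
      (hcard : (omp τ B y t).1.card = t) :
      FavorsSupport A (supp x) (omp τ B y t).1 (omp τ B y t).2 := by
    refine favorsSupport_of_coherence hunit hcoh hsub (hcard.trans_lt ht) ?_ (hout t ht _ rfl)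
    rw [toLp_omp_snd, residualProj_euclideanCol_restrictCols A hsub]
  have homp := omp_eq_omp_restrictCols hτ hfav
  refine ⟨?_, fun t ht => ?_⟩
  · obtain ⟨heq, hsub, hcard⟩ := homp _ le_rfl
    rw [heq]
    exact Finset.eq_of_subset_of_card_le hsub hcard.ge
  · obtain ⟨heq, hsub, hcard⟩ := homp t ht.le
    rw [heq]
    exact (hfav t ht hsub hcard).greedyCondition

end GreedySelection

section Measurability

variable {M N : ℕ} {α : Type*} [MeasurableSpace α] {A : α → Matrix (Fin M) (Fin N) ℂ}

theorem measurable_corr (hA : ∀ m n, Measurable fun a => A a m n) {r : α → Fin M → ℂ}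
    (hr : Measurable r) (n : Fin N) : Measurable fun a => corr (A a) (r a) n := by
  simp only [corr_eq_norm_sum]
  fun_prop

theorem measurable_maximizers (hA : ∀ m n, Measurable fun a => A a m n) {r : α → Fin M → ℂ}
    (hr : Measurable r) {T : α → Finset (Fin N)} (hT : Measurable T) :
    Measurable fun a => maximizers (A a) (r a) (T a) := by
  refine measurable_to_countable' fun s => ?_
  have hmem (n : Fin N) : MeasurableSet {a | n ∈ T a} :=
    hT (Set.to_countable {U | n ∈ U}).measurableSet
  simp only [Set.preimage, Set.mem_singleton_iff, Finset.ext_iff, mem_maximizers]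
  have hcorr := measurable_corr hA hr
  measurability

theorem measurable_omp (τ : Finset (Fin N) → Finset (Fin N) → Fin N)
    (hA : ∀ m n, Measurable fun a => A a m n) {y : α → Fin M → ℂ} (hy : Measurable y) (t : ℕ) :
    Measurable fun a => omp τ (A a) (y a) t := by
  have hres : Measurable fun p : α × Finset (Fin N) =>
      residualProj ℂ (euclideanCol (A p.1)) p.2 (WithLp.toLp 2 (y p.1)) := by
    refine measurable_from_prod_countable_left fun T => ?_
    refine measurable_residualProj (fun n => ?_) T (by fun_prop)
    exact (WithLp.measurable_toLp 2 _).comp (measurable_pi_lambda _ fun m => hA m n)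
  have hsnd {t : ℕ} (hfst : Measurable fun a => (omp τ (A a) (y a) t).1) :
      Measurable fun a => omp τ (A a) (y a) t := by
    refine hfst.prodMk ?_
    have hr := hres.comp (measurable_id.prodMk hfst)
    simp only [Function.comp_def, id, ← toLp_omp_snd] at hr
    exact (WithLp.measurable_ofLp 2 (Fin M → ℂ)).comp hr
  induction t with
  | zero => exact measurable_const.prodMk hy
  | succ t ih =>
    refine hsnd ?_
    exact (measurable_of_countable fun p : Finset (Fin N) × Finset (Fin N) =>
      insert (τ p.1 p.2) p.1).comp (ih.fst.prodMk (measurable_maximizers hA ih.snd ih.fst))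

end Measurability

section RandomPhase

variable {Ω : Type*} [MeasurableSpace Ω] {P : Measure Ω} {M N : ℕ}
  {A : Ω → Matrix (Fin M) (Fin N) ℂ} {S : Finset (Fin N)} {n : Fin N} {g : ℝ}

/-- A random matrix with independent entries of modulus `1 / √M`, each of which has a law that is
invariant under multiplication by `i`. Uniform phases have this property, and so do phases drawn
uniformly from `{0, π / 2, π, 3 π / 2}`. -/
structure IsRandomPhase (A : Ω → Matrix (Fin M) (Fin N) ℂ) (P : Measure Ω) : Prop where
  measurable : ∀ m n, Measurable fun ω => A ω m n
  norm_eq : ∀ ω m n, ‖A ω m n‖ = 1 / √M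
  identDistrib_I_mul : ∀ m n,
    IdentDistrib (fun ω => Complex.I * A ω m n) (fun ω => A ω m n) P P
  iIndepFun : iIndepFun (fun (p : Fin M × Fin N) ω => A ω p.1 p.2) P

theorem isRandomPhase_rprMatrix {Θ : Fin M → Fin N → Ω → ℝ} (hmeas : ∀ m n, Measurable (Θ m n))
    (hunif : ∀ m n, pdf.IsUniform (Θ m n) (Set.Ico 0 (2 * Real.pi)) P volume)
    (hindep : ProbabilityTheory.iIndepFun (fun (p : Fin M × Fin N) => Θ p.1 p.2) P) :
    IsRandomPhase (fun ω => rprMatrix fun m n => Θ m n ω) P where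
  measurable m n := by
    have := hmeas m n
    simp only [rprMatrix, Matrix.of_apply]
    fun_prop
  norm_eq ω m n := by
    rw [rprMatrix, Matrix.of_apply, norm_mul, mul_comm Complex.I, Complex.norm_exp_ofReal_mul_I,
      mul_one, Complex.norm_real, Real.norm_of_nonneg (by positivity)]
  identDistrib_I_mul m n := by
    simpa only [rprMatrix, Matrix.of_apply, mul_left_comm Complex.I] using
      (identDistrib_I_mul_exp_of_isUniform (hmeas m n) (hunif m n)).const_mul
        ((1 / √(M : ℝ) : ℝ) : ℂ)
  iIndepFun := hindep.comp
    (fun _ θ => ((1 / √(M : ℝ) : ℝ) : ℂ) * Complex.exp (Complex.I * (θ : ℂ))) fun _ => by fun_prop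

theorem restrictCols_restrictCols {T : Finset (Fin N)} (hST : S ⊆ T)
    (B : Matrix (Fin M) (Fin N) ℂ) : restrictCols S (restrictCols T B) = restrictCols S B := by
  ext m n
  by_cases hn : n ∈ S
  · simp [restrictCols, hn, hST hn]
  · simp [restrictCols, hn]

instance instMeasurableSpaceMatrix : MeasurableSpace (Matrix (Fin M) (Fin N) ℂ) :=
  inferInstanceAs (MeasurableSpace (Fin M → Fin N → ℂ))

theorem measurable_restrictCols :
    Measurable (restrictCols S : Matrix (Fin M) (Fin N) ℂ → Matrix (Fin M) (Fin N) ℂ) := by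
  refine measurable_pi_lambda _ fun m => measurable_pi_lambda _ fun n => ?_
  by_cases hn : n ∈ S
  · simp only [restrictCols, Matrix.of_apply, if_pos hn]
    exact (measurable_pi_apply n).comp (measurable_pi_apply m)
  · simp only [restrictCols, Matrix.of_apply, if_neg hn, measurable_const]

namespace IsRandomPhase

theorem norm_euclideanCol (hA : IsRandomPhase A P) (hM : 0 < M) (ω : Ω) (n : Fin N) :
    ‖euclideanCol (A ω) n‖ = 1 := by
  have hM' : (M : ℝ) ≠ 0 := by exact_mod_cast hM.ne'
  have hsq : ‖euclideanCol (A ω) n‖ ^ 2 = 1 := by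
    simp [euclideanCol, EuclideanSpace.norm_sq_eq, hA.norm_eq, hM']
  exact (pow_eq_one_iff_of_nonneg (norm_nonneg _) two_ne_zero).1 hsq

theorem indepFun_restrictCols (hA : IsRandomPhase A P) (n : Fin N) :
    IndepFun (fun ω m => A ω m n) (fun ω => restrictCols {n}ᶜ (A ω)) P := by
  let ψ (v : Fin M → {k // k ≠ n} → ℂ) : Matrix (Fin M) (Fin N) ℂ :=
    fun m k => if h : k ≠ n then v m ⟨k, h⟩ else 0
  have hψ : Measurable ψ := by
    refine measurable_pi_lambda _ fun m => measurable_pi_lambda _ fun k => ?_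
    by_cases h : k ≠ n
    · simp only [ψ, dif_pos h]
      fun_prop
    · simp only [ψ, dif_neg h, measurable_const]
  have hψA (ω : Ω) : ψ (fun m k => A ω m k) = restrictCols {n}ᶜ (A ω) := by
    ext m k
    by_cases h : k = n <;> simp [ψ, restrictCols, h]
  simpa only [Function.comp_def, id, hψA] using
    (indepFun_col_of_iIndepFun (fun p => hA.measurable p.1 p.2) hA.iIndepFun n).comp
      measurable_id hψ

variable [IsProbabilityMeasure P]

theorem measure_l2norm_div_le_corr_le (hA : IsRandomPhase A P) (hg : 2 < g) {s : ℝ} (hs : 0 ≤ s)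
    {F : Matrix (Fin M) (Fin N) ℂ → Fin M → ℂ} (hF : Measurable F)
    (hFn : ∀ B, F (restrictCols {n}ᶜ B) = F B) :
    P {ω | F (A ω) ≠ 0 ∧ l2norm (F (A ω)) / s ≤ corr (A ω) (F (A ω)) n} ≤
      ENNReal.ofReal ((1 - 2 / g) ^ (-(1 / 2) : ℝ) * Real.exp (-(M / (g * s ^ 2)))) := by
  have hmeas : Measurable A :=
    measurable_pi_lambda _ fun m => measurable_pi_lambda _ fun k => hA.measurable m k
  refine measure_l2norm_div_le_corr_le_of_indepFun (fun m => hA.measurable m n) hg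
    (fun m => .of_forall fun ω => (hA.norm_eq ω m n).le) (fun m => hA.identDistrib_I_mul m n)
    (hA.iIndepFun.precomp (g := fun m => (m, n)) fun m m' h => congrArg Prod.fst h) hs
    (hF.comp hmeas) ?_
  simpa only [Function.comp_def, id, hFn] using
    (hA.indepFun_restrictCols n).comp measurable_id hF

theorem measure_exists_l2norm_div_le_corr_le (hA : IsRandomPhase A P) (hg : 2 < g) {s : ℝ}
    (hs : 0 ≤ s) {ι : Type*} (I : Finset ι) {F : ι → Matrix (Fin M) (Fin N) ℂ → Fin M → ℂ}
    (hF : ∀ i ∈ I, Measurable (F i)) (hFn : ∀ i ∈ I, ∀ B, F i (restrictCols {n}ᶜ B) = F i B) :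
    P {ω | ∃ i ∈ I, F i (A ω) ≠ 0 ∧ l2norm (F i (A ω)) / s ≤ corr (A ω) (F i (A ω)) n} ≤
      I.card * ENNReal.ofReal ((1 - 2 / g) ^ (-(1 / 2) : ℝ) * Real.exp (-(M / (g * s ^ 2)))) := by
  have hunion (p : ι → Ω → Prop) : {ω | ∃ i ∈ I, p i ω} = ⋃ i ∈ I, {ω | p i ω} := by
    ext ω
    simp only [Set.mem_iUnion, Set.mem_ofPred_eq, exists_prop]
  rw [hunion, ← nsmul_eq_mul]
  exact (measure_biUnion_finset_le I _).trans (Finset.sum_le_card_nsmul I _ _ fun i hi =>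
    hA.measure_l2norm_div_le_corr_le hg hs (hF i hi) (hFn i hi))

theorem measure_exists_inv_card_le_norm_inner_le (hA : IsRandomPhase A P) (hM : 0 < M)
    (hg : 2 < g) (S : Finset (Fin N)) (n : Fin N) :
    P {ω | ∃ i ∈ S.erase n,
        1 / S.card ≤ ‖inner ℂ (euclideanCol (A ω) n) (euclideanCol (A ω) i)‖} ≤
      S.card * ENNReal.ofReal
        ((1 - 2 / g) ^ (-(1 / 2) : ℝ) * Real.exp (-(M / (g * (S.card : ℝ) ^ 2)))) := by
  have htail := hA.measure_exists_l2norm_div_le_corr_le (n := n) hg (Nat.cast_nonneg S.card)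
    (S.erase n) (F := fun i B m => B m i)
    (fun i _ => by fun_prop)
    (fun i hi B => by simp [restrictCols, Finset.ne_of_mem_erase hi])
  have hunit (ω : Ω) (i : Fin N) : l2norm (fun m => A ω m i) = 1 := hA.norm_euclideanCol hM ω i
  have hne (ω : Ω) (i : Fin N) : (fun m => A ω m i) ≠ 0 :=
    l2norm_pos.1 ((hunit ω i).symm ▸ one_pos)
  simp only [hunit, hne, ne_eq, not_false_eq_true, true_and, corr_eq_norm_inner] at htail
  refine htail.trans ?_
  gcongr
  exact Finset.erase_subset n S

theorem measure_exists_omp_residual_le (hA : IsRandomPhase A P) (hg : 2 < g)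
    (τ : Finset (Fin N) → Finset (Fin N) → Fin N) (x : Fin N → ℂ) (hn : n ∉ S) (k : ℕ) :
    P {ω | ∃ t ∈ Finset.range k, ∃ r,
        r = (omp τ (restrictCols S (A ω)) ((restrictCols S (A ω)).mulVec x) t).2 ∧
          r ≠ 0 ∧ l2norm r / S.card ≤ corr (A ω) r n} ≤
      k * ENNReal.ofReal
        ((1 - 2 / g) ^ (-(1 / 2) : ℝ) * Real.exp (-(M / (g * (S.card : ℝ) ^ 2)))) := by
  have hSn : S ⊆ {n}ᶜ := fun i hi => by simpa using ne_of_mem_of_not_mem hi hn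
  have hB (m : Fin M) (i : Fin N) :
      Measurable fun B : Matrix (Fin M) (Fin N) ℂ => restrictCols S B m i :=
    (measurable_pi_apply i).comp ((measurable_pi_apply m).comp measurable_restrictCols)
  have hy : Measurable fun B : Matrix (Fin M) (Fin N) ℂ => (restrictCols S B).mulVec x := by
    refine measurable_pi_lambda _ fun m => ?_
    simp only [Matrix.mulVec, dotProduct]
    fun_prop
  simpa only [Finset.card_range, exists_eq_left] using
    hA.measure_exists_l2norm_div_le_corr_le hg (Nat.cast_nonneg S.card) (Finset.range k)
      (F := fun t B => (omp τ (restrictCols S B) ((restrictCols S B).mulVec x) t).2)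
      (fun t _ => (measurable_omp τ hB hy t).snd)
      (fun t _ B => by rw [restrictCols_restrictCols hSn])

theorem measure_not_ssd_le (hA : IsRandomPhase A P) (hM : 0 < M) (hg : 2 < g)
    {τ : Finset (Fin N) → Finset (Fin N) → Fin N} (hτ : IsTieBreak τ) (x : Fin N → ℂ) :
    P {ω | ¬ SSD τ (A ω) x (supp x).card} ≤
      N * ((supp x).card * ENNReal.ofReal
        ((1 - 2 / g) ^ (-(1 / 2) : ℝ) * Real.exp (-(M / (g * ((supp x).card : ℝ) ^ 2))))) := by
  let incoherent (n : Fin N) : Set Ω := {ω | ∃ i ∈ (supp x).erase n,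
    1 / (supp x).card ≤ ‖inner ℂ (euclideanCol (A ω) n) (euclideanCol (A ω) i)‖}
  let misled (n : Fin N) : Set Ω := {ω | ∃ t ∈ Finset.range (supp x).card, ∃ r,
    r = (omp τ (restrictCols (supp x) (A ω)) ((restrictCols (supp x) (A ω)).mulVec x) t).2 ∧
      r ≠ 0 ∧ l2norm r / (supp x).card ≤ corr (A ω) r n}
  let bad (n : Fin N) : Set Ω := if n ∈ supp x then incoherent n else misled n
  have hcover : {ω | ¬ SSD τ (A ω) x (supp x).card} ⊆ ⋃ n ∈ Finset.univ, bad n := by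
    intro ω hω
    by_contra hbad
    simp only [Finset.mem_univ, Set.iUnion_true, Set.mem_iUnion, not_exists] at hbad
    refine hω (ssd_of_coherence hτ (fun i _ => hA.norm_euclideanCol hM ω i) ?_ ?_)
    · intro i hi k hk hik
      have hi_bad : ω ∉ incoherent i := by
        simpa only [bad, if_pos (Finset.mem_coe.1 hi)] using hbad i
      exact (not_le.1 fun hle => hi_bad ⟨k, Finset.mem_erase.2 ⟨hik.symm, hk⟩, hle⟩).le
    · intro t ht r hr hr0 n hn
      have hn_bad : ω ∉ misled n := by simpa only [bad, if_neg hn] using hbad n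
      exact not_le.1 fun hle => hn_bad ⟨t, Finset.mem_range.2 ht, r, hr, hr0, hle⟩
  have hbad_le (n : Fin N) : P (bad n) ≤ (supp x).card * ENNReal.ofReal
      ((1 - 2 / g) ^ (-(1 / 2) : ℝ) * Real.exp (-(M / (g * ((supp x).card : ℝ) ^ 2)))) := by
    by_cases hn : n ∈ supp x
    · simpa only [bad, if_pos hn] using
        hA.measure_exists_inv_card_le_norm_inner_le hM hg (supp x) n
    · simpa only [bad, if_neg hn] using hA.measure_exists_omp_residual_le hg τ x hn _
  refine (measure_mono hcover).trans ((measure_biUnion_finset_le _ _).trans ?_)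
  simpa only [Finset.card_univ, Fintype.card_fin, nsmul_eq_mul] using
    Finset.sum_le_card_nsmul Finset.univ _ _ fun n _ => hbad_le n

theorem le_measureReal_ssd_of_pos (hA : IsRandomPhase A P) (hM : 0 < M) (hg : 2 < g)
    {τ : Finset (Fin N) → Finset (Fin N) → Fin N} (hτ : IsTieBreak τ) (x : Fin N → ℂ) :
    1 - (1 - 2 / g) ^ (-(1 / 2) : ℝ) * ((supp x).card * N) *
        Real.exp (-(M / (g * ((supp x).card : ℝ) ^ 2))) ≤
      P.real {ω | SSD τ (A ω) x (supp x).card} := by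
  have hq : 0 ≤ 1 - 2 / g := sub_nonneg.2 ((div_lt_one (by linarith)).2 hg).le
  have hfail := ENNReal.toReal_mono (by finiteness) (hA.measure_not_ssd_le hM hg hτ x)
  rw [ENNReal.toReal_mul, ENNReal.toReal_mul, ENNReal.toReal_natCast, ENNReal.toReal_natCast,
    ENNReal.toReal_ofReal (by positivity)] at hfail
  have htotal : 1 ≤ P.real {ω | SSD τ (A ω) x (supp x).card} +
      P.real {ω | ¬ SSD τ (A ω) x (supp x).card} := by
    rw [← probReal_univ (μ := P), ← Set.union_compl_self {ω | SSD τ (A ω) x (supp x).card}]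
    exact measureReal_union_le _ _
  rw [measureReal_def P {ω | ¬ _}] at htotal
  linarith

theorem le_measureReal_ssd (hA : IsRandomPhase A P) (hg : 2 < g)
    {τ : Finset (Fin N) → Finset (Fin N) → Fin N} (hτ : IsTieBreak τ) (x : Fin N → ℂ) :
    1 - (1 - 2 / g) ^ (-(1 / 2) : ℝ) * ((supp x).card * N) *
        Real.exp (-(M / (g * ((supp x).card : ℝ) ^ 2))) ≤
      P.real {ω | SSD τ (A ω) x (supp x).card} := by
  obtain rfl | hM := M.eq_zero_or_pos
  swap
  · exact hA.le_measureReal_ssd_of_pos hM hg hτ x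
  obtain hx | ⟨i, hi⟩ := (supp x).eq_empty_or_nonempty
  · simp [SSD, omp, hx]
  have hK : (1 : ℝ) ≤ (supp x).card := by exact_mod_cast Finset.card_pos.2 ⟨i, hi⟩
  have hN : (1 : ℝ) ≤ N := by exact_mod_cast i.pos
  have hconst : 1 ≤ (1 - 2 / g) ^ (-(1 / 2) : ℝ) :=
    Real.one_le_rpow_of_pos_of_le_one_of_nonpos (sub_pos.2 ((div_lt_one (by linarith)).2 hg))
      (sub_le_self _ (by positivity)) (by norm_num)
  have hvacuous := one_le_mul_of_one_le_of_one_le hconst (one_le_mul_of_one_le_of_one_le hK hN)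
  refine le_trans ?_ measureReal_nonneg
  simpa using hvacuous

end IsRandomPhase

end RandomPhase

theorem mul_exp_neg_le_of_log_div_le {b ε t : ℝ} (hε : 0 < ε) (h : Real.log (b / ε) ≤ t) :
    b * Real.exp (-t) ≤ ε := by
  have hb : b ≤ Real.exp t * ε :=
    (div_le_iff₀ hε).1 ((Real.le_exp_log _).trans (Real.exp_le_exp.2 h))
  rwa [Real.exp_neg, ← div_eq_mul_inv, div_le_iff₀' (Real.exp_pos t)]

end RPR

end

theorem theorem2_general {Ω : Type*} [MeasurableSpace Ω] (P : Measure Ω) [IsProbabilityMeasure P]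
    (M N K : ℕ) (A : Ω → Matrix (Fin M) (Fin N) ℂ) (hA : RPR.IsRandomPhase A P)
    (x : Fin N → ℂ) (hx : (RPR.supp x).card = K)
    (τ : Finset (Fin N) → Finset (Fin N) → Fin N) (hτ : RPR.IsTieBreak τ)
    (g : ℝ) (hg : 2 < g) :
    P.real {ω | RPR.SSD τ (A ω) x K} ≥
        1 - (1 - 2 / g) ^ (-(1 / 2) : ℝ) * (K * N) * Real.exp (-(M / (g * (K : ℝ) ^ 2))) ∧
      ∀ ε : ℝ, 0 < ε →
        (M : ℝ) ≥ g * (K : ℝ) ^ 2 * Real.log (K * N / (ε * √(1 - 2 / g))) →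
        P.real {ω | RPR.SSD τ (A ω) x K} ≥ 1 - ε := by
  subst hx
  have hssd := hA.le_measureReal_ssd hg hτ x
  refine ⟨hssd, fun ε hε hM => le_trans (sub_le_sub_left ?_ 1) hssd⟩
  refine RPR.mul_exp_neg_le_of_log_div_le hε ?_
  have hq : 0 ≤ 1 - 2 / g := sub_nonneg.2 ((div_lt_one (by linarith)).2 hg).le
  have hconst : (1 - 2 / g) ^ (-(1 / 2) : ℝ) * ((RPR.supp x).card * N) / ε =
      (RPR.supp x).card * N / (ε * √(1 - 2 / g)) := by
    rw [Real.rpow_neg hq, ← Real.sqrt_eq_rpow, inv_mul_eq_div, div_div, mul_comm ε]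
  rw [hconst]
  obtain hK | hK := (RPR.supp x).card.eq_zero_or_pos
  · simp [hK]
  · rwa [le_div_iff₀' (by positivity)]

theorem theorem2 {Ω : Type*} [MeasurableSpace Ω] (P : Measure Ω) [IsProbabilityMeasure P]
    (M N K : ℕ) (Θ : Fin M → Fin N → Ω → ℝ)
    (hmeas : ∀ m n, Measurable (Θ m n))
    (hunif : ∀ m n, pdf.IsUniform (Θ m n) (Set.Ico 0 (2 * Real.pi)) P volume)
    (hindep : iIndepFun (fun (p : Fin M × Fin N) => Θ p.1 p.2) P)
    (x : Fin N → ℂ) (hx : (RPR.supp x).card = K)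
    (τ : Finset (Fin N) → Finset (Fin N) → Fin N) (hτ : RPR.IsTieBreak τ)
    (g : ℝ) (hg : 2 < g) :
    P.real {ω | RPR.SSD τ (RPR.rprMatrix fun m n => Θ m n ω) x K} ≥
        1 - (1 - 2 / g) ^ (-(1 / 2) : ℝ) * (K * N) * Real.exp (-(M / (g * (K : ℝ) ^ 2))) ∧
      ∀ ε : ℝ, 0 < ε → ε < 1 →
        (M : ℝ) ≥ g * (K : ℝ) ^ 2 * Real.log (K * N / (ε * √(1 - 2 / g))) →
        P.real {ω | RPR.SSD τ (RPR.rprMatrix fun m n => Θ m n ω) x K} ≥ 1 - ε := by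
  have hA := RPR.isRandomPhase_rprMatrix hmeas hunif hindep
  exact (theorem2_general P M N K _ hA x hx τ hτ g hg).imp_right fun h ε hε _ => h ε hε
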